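/- **Theorem 3.** Let $1\le k\le n$ and $\delta>0$. Call a distribution on $\{-1,1\}^n$ *$k$-wise uniform* if its marginal on every set of $k$ coordinates is uniform, and *$\delta$-far from $k$-wise uniform* if its total variation distance to every $k$-wise uniform distribution exceeds $\delta$. A *$\delta$-tester for $k$-wise uniformity* with $m$ samples and error probability $\eta$ is a decision rule which, given $m$ independent samples from an unknown distribution $\varphi$ on $\{-1,1\}^n$, outputs "Yes" with probability at least $1-\eta$ whenever $\varphi$ is $k$-wise uniform, and outputs "No" with probability at least $1-\eta$ whenever $\varphi$ is $\delta$-far from $k$-wise uniform. For every $\eta\in(0,1)$ there is a constant $C=C(\eta)>0$, depending on nothing else, such that: 1. for all $1\le k\le n$ and all $\delta>0$ there is a $\delta$-tester for $k$-wise uniformity of distributions on $\{-1,1\}^n$, with error probability $\eta$, whose number of samples is at most $$\left(\frac{C}{k}\right)^{k/2}\frac{n^k}{\delta^2};$$ 2. for $k=1$, all $n\ge 2$ and all $\delta>0$, there is such a tester whose number of samples is at most $$C\,\frac{\log n}{\delta^2}.$$ -/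

import Mathlib

/-- The discrete cube `{-1, 1}^n`; `ℤˣ` is the two-element set `{1, -1}`. -/
abbrev Cube (n : ℕ) : Type := Fin n → ℤˣ

/-- `φ` is a density on `{-1, 1}^n` with respect to the uniform distribution: it is nonnegative
and has mean `1`. It stands for the distribution that gives `x` the probability `φ x / 2 ^ n`. -/
structure IsDensity {n : ℕ} (φ : Cube n → ℝ) : Prop where
  nonneg : ∀ x, 0 ≤ φ x
  mean_one : (∑ x, φ x) / 2 ^ n = 1

/-- The probability that `x ∼ φ` agrees with `y` on the coordinates in `S`. As `y` varies, these
are the point probabilities of the marginal of `φ` on `S`. -/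
noncomputable def marginalProb {n : ℕ} (φ : Cube n → ℝ) (S : Finset (Fin n)) (y : Cube n) : ℝ :=
  ∑ x with ∀ i ∈ S, x i = y i, φ x / 2 ^ n

/-- `φ` is (the density of) a `k`-wise uniform distribution: its marginal on every set of `k`
coordinates is uniform. -/
structure IsKWiseUniform {n : ℕ} (k : ℕ) (φ : Cube n → ℝ) : Prop where
  isDensity : IsDensity φ
  marginal_uniform : ∀ S : Finset (Fin n), S.card = k → ∀ y : Cube n,
    marginalProb φ S y = 1 / 2 ^ k

/-- Total variation distance of two densities, `(1/2) 𝔼 |φ - ψ|`. -/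
noncomputable def dTV {n : ℕ} (φ ψ : Cube n → ℝ) : ℝ :=
  1 / 2 * ((∑ x, |φ x - ψ x|) / 2 ^ n)

/-- `φ` is `δ`-far from every `k`-wise uniform distribution. -/
def IsFarFromKWise {n : ℕ} (k : ℕ) (δ : ℝ) (φ : Cube n → ℝ) : Prop :=
  ∀ ψ : Cube n → ℝ, IsKWiseUniform k ψ → δ < dTV φ ψ

/-- The probability that the decision rule `T` outputs `b` on `m` independent samples from `φ`. -/
noncomputable def outputProb {n m : ℕ} (φ : Cube n → ℝ) (T : (Fin m → Cube n) → Bool)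
    (b : Bool) : ℝ :=
  ∑ X with T X = b, ∏ s, φ (X s) / 2 ^ n

/-- The decision rule `T` on `m` samples (output `true` meaning "Yes") is a `δ`-tester for
`k`-wise uniformity on `{-1, 1}^n` with error probability at most `η`. -/
structure IsTester {n m : ℕ} (k : ℕ) (δ η : ℝ) (T : (Fin m → Cube n) → Bool) : Prop where
  complete : ∀ φ : Cube n → ℝ, IsKWiseUniform k φ → 1 - η ≤ outputProb φ T true
  sound : ∀ φ : Cube n → ℝ, IsDensity φ → IsFarFromKWise k δ φ → 1 - η ≤ outputProb φ T false

/-- Some `δ`-tester for `k`-wise uniformity on `{-1, 1}^n`, with error probability at most `η`,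
uses `m` samples. -/
def HasTester (n k : ℕ) (δ η : ℝ) (m : ℕ) : Prop :=
  ∃ T : (Fin m → Cube n) → Bool, IsTester k δ η T

/-! For `k ≤ n`, a density is `k`-wise uniform exactly when its Fourier coefficients at nonempty
sets of size at most `k` vanish, so the testers estimate these coefficients empirically. What is
needed is that a density far from `k`-wise uniform has large low-degree coefficients.

Contrapositively, suppose some density `ρ` has low-degree coefficients `-1/δ` times those of `φ`.
Then `(φ + δρ)/(1 + δ)` is `k`-wise uniform and within `δ` of `φ`. Such a `ρ` exists when the
prescribed coefficients satisfy `9 ^ k * ∑ c S ^ 2 ≤ 1` (`exists_density_of_sum_sq_le`). Otherwise a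
separating hyperplane yields a nonnegative polynomial of degree at most `k`, and hypercontractivity
bounds its `L²` norm by its mean, contradicting separation. For `k = 1` a product density shows that
coefficients bounded by `1` suffice.

For general `k`, Chebyshev-type control of the total squared error requires about `9 ^ k * |lowSets
n k| / δ ^ 2` samples, and `|lowSets n k| ≤ (3n/k) ^ k`. For `k = 1` only one large coefficient must
be detected, so exponential tail bounds and a union bound over `n` coordinates give `log n / δ ^ 2`.
-/

/-! ### Characters and sign flips -/

/-- The character `x ↦ ∏ i ∈ S, x i` of the cube. -/
def cubeChar {n : ℕ} (S : Finset (Fin n)) (x : Cube n) : ℝ := ∏ i ∈ S, ((x i : ℤ) : ℝ)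

/-- The point `x` with the sign of its `i`-th coordinate flipped. -/
def flipAt {n : ℕ} (i : Fin n) (x : Cube n) : Cube n := Function.update x i (-x i)

lemma flipAt_involutive {n : ℕ} (i : Fin n) : Function.Involutive (flipAt i) := by
  intro x
  simp [flipAt]

lemma sum_eq_zero_of_flipAt_neg {n : ℕ} (i : Fin n) (F : Cube n → ℝ)
    (hF : ∀ x, F (flipAt i x) = -F x) : ∑ x, F x = 0 := by
  have h := Equiv.sum_comp (flipAt_involutive i).toPerm F
  simp only [Function.Involutive.coe_toPerm, hF, Finset.sum_neg_distrib] at h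
  linarith

lemma cubeChar_flipAt_of_notMem {n : ℕ} {i : Fin n} {S : Finset (Fin n)} (hi : i ∉ S)
    (x : Cube n) : cubeChar S (flipAt i x) = cubeChar S x := by
  refine Finset.prod_congr rfl fun j hj => ?_
  rw [flipAt, Function.update_of_ne (ne_of_mem_of_not_mem hj hi)]

lemma cubeChar_insert {n : ℕ} {i : Fin n} {S : Finset (Fin n)} (hi : i ∉ S)
    (x : Cube n) : cubeChar (insert i S) x = ((x i : ℤ) : ℝ) * cubeChar S x :=
  Finset.prod_insert hi

lemma unit_coe_sq (u : ℤˣ) : ((u : ℤ) : ℝ) ^ 2 = 1 := by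
  rcases Int.units_eq_one_or u with h | h <;> simp [h]

lemma cubeChar_sq {n : ℕ} (S : Finset (Fin n)) (x : Cube n) : cubeChar S x ^ 2 = 1 := by
  simp [cubeChar, ← Finset.prod_pow, unit_coe_sq]

lemma abs_cubeChar {n : ℕ} (S : Finset (Fin n)) (x : Cube n) : |cubeChar S x| = 1 :=
  (sq_eq_sq₀ (abs_nonneg _) zero_le_one).1 (by rw [sq_abs, cubeChar_sq, one_pow])

@[simp] lemma cubeChar_empty {n : ℕ} (x : Cube n) : cubeChar ∅ x = 1 := rfl

lemma cubeChar_flipAt_of_mem {n : ℕ} {i : Fin n} {S : Finset (Fin n)} (hi : i ∈ S)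
    (x : Cube n) : cubeChar S (flipAt i x) = -cubeChar S x := by
  rw [← Finset.insert_erase hi, cubeChar_insert (Finset.notMem_erase i S),
    cubeChar_insert (Finset.notMem_erase i S),
    cubeChar_flipAt_of_notMem (Finset.notMem_erase i S)]
  simp [flipAt]

lemma sum_cubeChar {n : ℕ} {S : Finset (Fin n)} (hS : S.Nonempty) :
    ∑ x, cubeChar S x = 0 := by
  obtain ⟨i, hi⟩ := hS
  exact sum_eq_zero_of_flipAt_neg i _ (cubeChar_flipAt_of_mem hi)

lemma card_cube (n : ℕ) : (Fintype.card (Cube n) : ℝ) = 2 ^ n := by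
  simp [Fintype.card_pi]

/-! ### Parseval and hypercontractivity -/

/-- The mean of a function on the cube. -/
noncomputable def cubeMean {n : ℕ} (f : Cube n → ℝ) : ℝ := (∑ x, f x) / 2 ^ n

/-- The multilinear polynomial with coefficients `c`, restricted to the monomials inside `T`. -/
def cubePoly {n : ℕ} (T : Finset (Fin n)) (c : Finset (Fin n) → ℝ) (x : Cube n) : ℝ :=
  ∑ S ∈ T.powerset, c S * cubeChar S x

/-- Isolating one variable, `p = q + x i * r` with `q` and `r` free of `x i`, drives the inductions
on the set of variables. -/
lemma cubePoly_insert {n : ℕ} {i : Fin n} {T : Finset (Fin n)} (hi : i ∉ T)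
    (c : Finset (Fin n) → ℝ) (x : Cube n) :
    cubePoly (insert i T) c x
      = cubePoly T c x + ((x i : ℤ) : ℝ) * cubePoly T (fun S => c (insert i S)) x := by
  rw [cubePoly, Finset.sum_powerset_insert hi, cubePoly, cubePoly, Finset.mul_sum]
  congr 1
  refine Finset.sum_congr rfl fun S hS => ?_
  rw [cubeChar_insert (fun h => hi (Finset.mem_powerset.1 hS h))]
  ring

lemma cubePoly_flipAt {n : ℕ} {i : Fin n} {T : Finset (Fin n)} (hi : i ∉ T)
    (c : Finset (Fin n) → ℝ) (x : Cube n) : cubePoly T c (flipAt i x) = cubePoly T c x := by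
  refine Finset.sum_congr rfl fun S hS => ?_
  rw [cubeChar_flipAt_of_notMem (fun h => hi (Finset.mem_powerset.1 hS h))]

lemma cubeMean_coord_mul {n : ℕ} (i : Fin n) (F : Cube n → ℝ)
    (hF : ∀ x, F (flipAt i x) = F x) : cubeMean (fun x => ((x i : ℤ) : ℝ) * F x) = 0 := by
  rw [cubeMean, sum_eq_zero_of_flipAt_neg i, zero_div]
  intro x
  rw [hF]
  simp [flipAt]

lemma cubeMean_add {n : ℕ} (f g : Cube n → ℝ) :
    cubeMean (fun x => f x + g x) = cubeMean f + cubeMean g := by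
  simp [cubeMean, Finset.sum_add_distrib, add_div]

lemma cubeMean_const_mul {n : ℕ} (a : ℝ) (f : Cube n → ℝ) :
    cubeMean (fun x => a * f x) = a * cubeMean f := by
  simp [cubeMean, ← Finset.mul_sum, mul_div_assoc]

lemma cubeMean_const {n : ℕ} (a : ℝ) : cubeMean (fun _ : Cube n => a) = a := by
  rw [cubeMean, Finset.sum_const, Finset.card_univ, nsmul_eq_mul, card_cube]
  field_simp

lemma cubeMean_nonneg {n : ℕ} {f : Cube n → ℝ} (hf : ∀ x, 0 ≤ f x) : 0 ≤ cubeMean f :=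
  div_nonneg (Finset.sum_nonneg fun x _ => hf x) (by positivity)

lemma cubeMean_sq_le_of_sq_eq_mul {n : ℕ} {r f g : Cube n → ℝ} (hf : ∀ x, 0 ≤ f x)
    (hg : ∀ x, 0 ≤ g x) (h : ∀ x, r x ^ 2 = f x * g x) :
    cubeMean r ^ 2 ≤ cubeMean f * cubeMean g := by
  rw [cubeMean, cubeMean, cubeMean, div_pow, div_mul_div_comm, ← sq]
  gcongr
  exact Finset.sum_sq_le_sum_mul_sum_of_sq_le_mul _ (fun x _ => hf x) (fun x _ => hg x)
    (fun x _ => (h x).le)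

/-- Parseval's identity. -/
lemma cubeMean_cubePoly_sq {n : ℕ} (T : Finset (Fin n)) (c : Finset (Fin n) → ℝ) :
    cubeMean (fun x => cubePoly T c x ^ 2) = ∑ S ∈ T.powerset, c S ^ 2 := by
  induction T using Finset.induction_on generalizing c with
  | empty => simp [cubePoly, cubeMean_const]
  | insert i T hi ih =>
    -- The cross term `2 * x i * q * r` is odd in `x i`, so its mean is zero and it may be added
    -- freely.
    rw [Finset.sum_powerset_insert hi, ← ih, ← ih, ← cubeMean_add,
      ← add_zero (cubeMean _), ← cubeMean_coord_mul i
        (fun x => -2 * (cubePoly T c x * cubePoly T (fun S => c (insert i S)) x))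
        (fun x => by simp only [cubePoly_flipAt hi]), ← cubeMean_add]
    congr 1
    funext x
    rw [cubePoly_insert hi]
    linear_combination (cubePoly T (fun S => c (insert i S)) x) ^ 2 * unit_coe_sq (x i)

/-- Bonami's lemma: a polynomial of degree at most `k` is `9 ^ k`-reasonable. -/
lemma cubeMean_cubePoly_pow_four {n : ℕ} (T : Finset (Fin n)) (k : ℕ)
    (c : Finset (Fin n) → ℝ) (hc : ∀ S ⊆ T, k < S.card → c S = 0) :
    cubeMean (fun x => cubePoly T c x ^ 4)
      ≤ 9 ^ k * cubeMean (fun x => cubePoly T c x ^ 2) ^ 2 := by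
  induction T using Finset.induction_on generalizing c k with
  | empty =>
    simp only [cubePoly, Finset.powerset_empty, Finset.sum_singleton, cubeChar_empty, mul_one,
      cubeMean_const]
    have : (1 : ℝ) ≤ 9 ^ k := one_le_pow₀ (by norm_num)
    nlinarith [sq_nonneg (c ∅ ^ 2)]
  | insert i T hi ih =>
    set q := cubePoly T c with hq
    set r := cubePoly T (fun S => c (insert i S)) with hr
    have hqf : ∀ x, q (flipAt i x) = q x := cubePoly_flipAt hi c
    have hrf : ∀ x, r (flipAt i x) = r x := cubePoly_flipAt hi _
    have h2 : cubeMean (fun x => cubePoly (insert i T) c x ^ 2)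
        = cubeMean (fun x => q x ^ 2) + cubeMean (fun x => r x ^ 2) := by
      rw [← cubeMean_add, ← add_zero (cubeMean _), ← cubeMean_coord_mul i
        (fun x => -2 * (q x * r x)) (fun x => by simp only [hqf, hrf]), ← cubeMean_add]
      congr 1
      funext x
      rw [cubePoly_insert hi]
      linear_combination (r x) ^ 2 * unit_coe_sq (x i)
    have h4 : cubeMean (fun x => cubePoly (insert i T) c x ^ 4)
        = cubeMean (fun x => q x ^ 4) + 6 * cubeMean (fun x => q x ^ 2 * r x ^ 2)
          + cubeMean (fun x => r x ^ 4) := by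
      rw [← cubeMean_const_mul, ← cubeMean_add, ← cubeMean_add, ← add_zero (cubeMean _),
        ← cubeMean_coord_mul i (fun x => -4 * (q x ^ 3 * r x) - 4 * (q x * r x ^ 3))
        (fun x => by simp only [hqf, hrf]), ← cubeMean_add]
      congr 1
      funext x
      rw [cubePoly_insert hi, ← hq, ← hr]
      have hu := unit_coe_sq (x i)
      linear_combination (6 * q x ^ 2 * r x ^ 2 + 4 * q x * r x ^ 3 * ((x i : ℤ) : ℝ)
        + r x ^ 4 * (((x i : ℤ) : ℝ) ^ 2 + 1)) * hu
    have hcs : cubeMean (fun x => q x ^ 2 * r x ^ 2) ^ 2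
        ≤ cubeMean (fun x => q x ^ 4) * cubeMean (fun x => r x ^ 4) :=
      cubeMean_sq_le_of_sq_eq_mul (fun x => by positivity) (fun x => by positivity)
        (fun x => by ring)
    have hqk := ih k c (fun S hS => hc S (hS.trans (Finset.subset_insert _ _)))
    have hA : 0 ≤ cubeMean (fun x => q x ^ 2) := cubeMean_nonneg fun x => sq_nonneg _
    have hB : 0 ≤ cubeMean (fun x => r x ^ 2) := cubeMean_nonneg fun x => sq_nonneg _
    have hr4 : 0 ≤ cubeMean (fun x => r x ^ 4) := cubeMean_nonneg fun x => by positivity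
    rw [h2, h4]
    rw [← hq] at hqk
    set A := cubeMean (fun x => q x ^ 2)
    set B := cubeMean (fun x => r x ^ 2)
    -- The cofactor `r` has degree at most `k - 1`, which gains a factor `9`; for `k = 0` it
    -- vanishes.
    have hrk : 9 * cubeMean (fun x => r x ^ 4) ≤ 9 ^ k * B ^ 2 := by
      cases k with
      | zero =>
        have : r = fun _ => 0 := by
          funext x
          refine Finset.sum_eq_zero fun S hS => ?_
          simp only
          rw [hc _ (Finset.insert_subset_insert i (Finset.mem_powerset.1 hS))
            (Finset.card_pos.2 (Finset.insert_nonempty i S)), zero_mul]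
        simp only [this, ne_eq, OfNat.ofNat_ne_zero, not_false_eq_true, zero_pow, cubeMean_const, mul_zero]
        positivity
      | succ k =>
        have := ih k (fun S => c (insert i S)) (fun S hS hk => hc _
          (Finset.insert_subset_insert i hS) (by
            rw [Finset.card_insert_of_notMem (fun h => hi (hS h))]; omega))
        rw [← hr] at this
        rw [pow_succ]
        linarith
    have hP : (0 : ℝ) ≤ 9 ^ k := by positivity
    -- The gain `9 = 3 ^ 2` turns the binomial coefficient `6` into the `2` of `(A + B) ^ 2`.
    have hmix : 3 * cubeMean (fun x => q x ^ 2 * r x ^ 2) ≤ 9 ^ k * (A * B) := by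
      refine abs_le_of_sq_le_sq' ?_ (by positivity) |>.2
      calc (3 * cubeMean (fun x => q x ^ 2 * r x ^ 2)) ^ 2
          ≤ cubeMean (fun x => q x ^ 4) * (9 * cubeMean (fun x => r x ^ 4)) := by linarith
        _ ≤ (9 ^ k * A ^ 2) * (9 ^ k * B ^ 2) := by gcongr
        _ = (9 ^ k * (A * B)) ^ 2 := by ring
    have hfin : (9 : ℝ) ^ k * (A + B) ^ 2 = 9 ^ k * A ^ 2 + 2 * (9 ^ k * (A * B)) + 9 ^ k * B ^ 2 := by
      ring
    linarith

/-- For nonnegative polynomials of degree at most `k`, the second moment is controlled by the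
first. -/
lemma cubeMean_cubePoly_sq_le {n : ℕ} (T : Finset (Fin n)) (k : ℕ)
    (c : Finset (Fin n) → ℝ) (hc : ∀ S ⊆ T, k < S.card → c S = 0)
    (h0 : ∀ x, 0 ≤ cubePoly T c x) :
    cubeMean (fun x => cubePoly T c x ^ 2) ≤ 9 ^ k * cubeMean (cubePoly T c) ^ 2 := by
  set p := cubePoly T c
  have h4 := cubeMean_cubePoly_pow_four T k c hc
  have h13 : cubeMean (fun x => p x ^ 2) ^ 2 ≤ cubeMean p * cubeMean (fun x => p x ^ 3) :=
    cubeMean_sq_le_of_sq_eq_mul h0 (fun x => pow_nonneg (h0 x) 3) (fun x => by ring)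
  have h24 : cubeMean (fun x => p x ^ 3) ^ 2
      ≤ cubeMean (fun x => p x ^ 2) * cubeMean (fun x => p x ^ 4) :=
    cubeMean_sq_le_of_sq_eq_mul (fun x => by positivity) (fun x => by positivity)
      (fun x => by ring)
  have hA : 0 ≤ cubeMean (fun x => p x ^ 2) := cubeMean_nonneg fun x => sq_nonneg _
  change cubeMean (fun x => p x ^ 4) ≤ _ at h4
  set A := cubeMean (fun x => p x ^ 2)
  rcases hA.eq_or_lt with hA | hA
  · rw [← hA]; positivity
  -- Two Cauchy–Schwarz steps interpolate the second moment between the first and the fourth; then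
  -- `A ^ 3` cancels.
  have : A ^ 3 * A ≤ A ^ 3 * (9 ^ k * cubeMean p ^ 2) := by
    calc A ^ 3 * A = (A ^ 2) ^ 2 := by ring
      _ ≤ (cubeMean p * cubeMean (fun x => p x ^ 3)) ^ 2 := by gcongr
      _ = cubeMean p ^ 2 * cubeMean (fun x => p x ^ 3) ^ 2 := by ring
      _ ≤ cubeMean p ^ 2 * (A * cubeMean (fun x => p x ^ 4)) := by gcongr
      _ ≤ cubeMean p ^ 2 * (A * (9 ^ k * A ^ 2)) := by gcongr
      _ = _ := by ring
  exact le_of_mul_le_mul_left this (by positivity)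

/-! ### Densities with prescribed low-degree coefficients -/

/-- The nonempty sets of at most `k` coordinates. -/
def lowSets (n k : ℕ) : Finset (Finset (Fin n)) := {S | S.Nonempty ∧ S.card ≤ k}

lemma mem_lowSets {n k : ℕ} {S : Finset (Fin n)} :
    S ∈ lowSets n k ↔ S.Nonempty ∧ S.card ≤ k := by simp [lowSets]

/-- The Fourier coefficient at `S` of the density `φ`. -/
noncomputable def cubeCoeff {n : ℕ} (φ : Cube n → ℝ) (S : Finset (Fin n)) : ℝ :=
  ∑ x, φ x / 2 ^ n * cubeChar S x

lemma IsDensity.sum_weights {n : ℕ} {φ : Cube n → ℝ} (hφ : IsDensity φ) :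
    ∑ x, φ x / 2 ^ n = 1 := by rw [← Finset.sum_div, hφ.mean_one]

lemma cubeMean_cubePoly {n : ℕ} (T : Finset (Fin n)) (c : Finset (Fin n) → ℝ) :
    cubeMean (cubePoly T c) = c ∅ := by
  unfold cubeMean cubePoly
  rw [Finset.sum_comm, Finset.sum_eq_single ∅]
  · simp [Fintype.card_pi]
  · intro S _ hS
    rw [← Finset.mul_sum, sum_cubeChar (Finset.nonempty_iff_ne_empty.2 hS), mul_zero]
  · simp

/-- A small enough prescription of the low-degree Fourier coefficients is attained by some
density. -/
lemma exists_density_of_sum_sq_le {n k : ℕ} (c : Finset (Fin n) → ℝ)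
    (hc : 9 ^ k * ∑ S ∈ lowSets n k, c S ^ 2 ≤ 1) :
    ∃ ρ : Cube n → ℝ, IsDensity ρ ∧ ∀ S ∈ lowSets n k, cubeCoeff ρ S = c S := by
  let L : (Cube n → ℝ) →ₗ[ℝ] (Finset (Fin n) → ℝ) :=
    { toFun := fun w S => if S ∈ lowSets n k then ∑ x, w x * cubeChar S x else 0
      map_add' := fun v w => by
        ext S
        by_cases hS : S ∈ lowSets n k <;> simp [hS, add_mul, Finset.sum_add_distrib]
      map_smul' := fun a w => by
        ext S
        by_cases hS : S ∈ lowSets n k <;> simp [hS, mul_assoc, Finset.mul_sum] }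
  have hL : ∀ w S, L w S = if S ∈ lowSets n k then ∑ x, w x * cubeChar S x else 0 :=
    fun _ _ => rfl
  let d : Finset (Fin n) → ℝ := fun S => if S ∈ lowSets n k then c S else 0
  -- The attainable coefficient vectors form the image of the probability simplex, which is compact
  -- and convex; a point outside it is strictly separated.
  have hmem : d ∈ L '' stdSimplex ℝ (Cube n) := by
    by_contra hd
    obtain ⟨f, u, hfu, hud⟩ := geometric_hahn_banach_closed_point
      ((convex_stdSimplex ℝ (Cube n)).linear_image L)
      ((isCompact_stdSimplex ℝ (Cube n)).image L.continuous_of_finiteDimensional).isClosed hd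
    let b : Finset (Fin n) → ℝ := fun S => f fun j => if S = j then 1 else 0
    have hf : ∀ v, f v = ∑ S, v S * b S := fun v =>
      LinearMap.pi_apply_eq_sum_univ f.toLinearMap v
    -- Coefficients of `u - ∑ b S * χ_S`, the slack of the separating inequality at the point
    -- masses. It is nonnegative with mean `u`.
    let a : Finset (Fin n) → ℝ := fun S =>
      if S ∈ lowSets n k then -b S else if S = ∅ then u else 0
    have hempty : (∅ : Finset (Fin n)) ∉ lowSets n k := by simp [mem_lowSets]
    have ha0 : a ∅ = u := by simp [a, hempty]
    have hsplit : ∀ g : Finset (Fin n) → ℝ → ℝ, (∀ S, g S 0 = 0) →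
        ∑ S, g S (a S) = g ∅ u + ∑ S ∈ lowSets n k, g S (-b S) := by
      intro g hg
      have hlow : ∑ S ∈ lowSets n k, g S (-b S) = ∑ S ∈ lowSets n k, g S (a S) :=
        Finset.sum_congr rfl fun S hS => by simp [a, hS]
      rw [hlow, ← ha0, ← Finset.sum_insert (f := fun S => g S (a S)) hempty]
      refine (Finset.sum_subset (Finset.subset_univ _) fun S _ hS => ?_).symm
      rw [Finset.mem_insert, not_or] at hS
      simp [a, hS, hg]
    have hp : ∀ x, 0 ≤ cubePoly Finset.univ a x := by
      intro x
      have h1 := hfu (L (Pi.single x 1)) ⟨_, single_mem_stdSimplex ℝ x, rfl⟩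
      have h2 : f (L (Pi.single x 1)) = ∑ S ∈ lowSets n k, cubeChar S x * b S := by
        rw [hf]
        simp [hL, Pi.single_apply]
      have h3 : cubePoly Finset.univ a x = u - ∑ S ∈ lowSets n k, cubeChar S x * b S := by
        rw [cubePoly, Finset.powerset_univ, hsplit (fun S t => t * cubeChar S x) (by simp)]
        simp [sub_eq_add_neg, mul_comm]
      linarith
    have hdeg : ∀ S ⊆ Finset.univ, k < S.card → a S = 0 := by
      intro S _ hS
      have h1 : S ∉ lowSets n k := by rw [mem_lowSets]; omega
      have h2 : S ≠ ∅ := by rintro rfl; simp at hS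
      simp [a, h1, h2]
    -- By Parseval this reads `u ^ 2 + ∑ b S ^ 2 ≤ 9 ^ k * u ^ 2`; Cauchy–Schwarz then forces `f d ≤
    -- u`.
    have hmain := cubeMean_cubePoly_sq_le Finset.univ k a hdeg hp
    have hu : 0 ≤ u := by
      rw [← ha0, ← cubeMean_cubePoly Finset.univ a]
      exact cubeMean_nonneg hp
    rw [cubeMean_cubePoly_sq, cubeMean_cubePoly, ha0, Finset.powerset_univ,
      hsplit (fun _ t => t ^ 2) (by simp)] at hmain
    simp only [neg_sq] at hmain
    have hfd : f d = ∑ S ∈ lowSets n k, c S * b S := by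
      rw [hf]
      simp [d]
    have hsq : f d ^ 2 ≤ u ^ 2 := by
      calc f d ^ 2 ≤ (∑ S ∈ lowSets n k, c S ^ 2) * ∑ S ∈ lowSets n k, b S ^ 2 := by
            rw [hfd]; exact Finset.sum_mul_sq_le_sq_mul_sq _ _ _
        _ ≤ (∑ S ∈ lowSets n k, c S ^ 2) * (9 ^ k * u ^ 2) := by
            gcongr
            nlinarith [sq_nonneg u]
        _ = (9 ^ k * ∑ S ∈ lowSets n k, c S ^ 2) * u ^ 2 := by ring
        _ ≤ 1 * u ^ 2 := by gcongr
        _ = u ^ 2 := one_mul _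
    exact absurd (abs_le_of_sq_le_sq' hsq hu).2 (not_le.2 hud)
  obtain ⟨w, hw, hwd⟩ := hmem
  refine ⟨fun x => 2 ^ n * w x, ⟨fun x => mul_nonneg (by positivity) (hw.1 x), ?_⟩, ?_⟩
  · rw [← Finset.mul_sum, hw.2, mul_one, div_self (by positivity)]
  · intro S hS
    have := congrFun hwd S
    simp only [hL, hS, if_true, d] at this
    rw [← this, cubeCoeff]
    refine Finset.sum_congr rfl fun x _ => ?_
    field_simp

/-- Any first-order Fourier coefficients in `[-1, 1]` are attained by a product density. -/
lemma exists_density_of_abs_le {n : ℕ} (c : Finset (Fin n) → ℝ)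
    (hc : ∀ S ∈ lowSets n 1, |c S| ≤ 1) :
    ∃ ρ : Cube n → ℝ, IsDensity ρ ∧ ∀ S ∈ lowSets n 1, cubeCoeff ρ S = c S := by
  have hs : ∀ i : Fin n, {i} ∈ lowSets n 1 := fun i => by simp [mem_lowSets]
  let ρ : Cube n → ℝ := fun x => ∏ i, (1 + c {i} * ((x i : ℤ) : ℝ))
  have hprod : ∀ g : Fin n → ℤˣ → ℝ,
      ∑ x : Cube n, ∏ i, g i (x i) = ∏ i, (g i 1 + g i (-1)) := by
    intro g
    rw [← Fintype.prod_sum]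
    refine Finset.prod_congr rfl fun i _ => ?_
    rw [UnitsInt.univ, Finset.sum_pair (by decide)]
  refine ⟨ρ, ⟨fun x => Finset.prod_nonneg fun i _ => ?_, ?_⟩, ?_⟩
  · have := abs_le.1 (hc _ (hs i))
    rcases Int.units_eq_one_or (x i) with h | h <;> simp [h] <;> linarith
  · rw [hprod (fun i u => 1 + c {i} * ((u : ℤ) : ℝ))]
    have : ∀ i : Fin n, (1 + c {i} * (((1 : ℤˣ) : ℤ) : ℝ)) +
        (1 + c {i} * (((-1 : ℤˣ) : ℤ) : ℝ)) = 2 := fun i => by simp; ring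
    simp only [this]
    simp
  · intro S hS
    obtain ⟨i, rfl⟩ : ∃ i, S = {i} := by
      rw [← Finset.card_eq_one]
      rw [mem_lowSets, ← Finset.card_pos] at hS
      omega
    have h1 : ∀ x : Cube n, ρ x * cubeChar {i} x
        = ∏ j, (1 + c {j} * ((x j : ℤ) : ℝ)) * (if j = i then ((x j : ℤ) : ℝ) else 1) := by
      intro x
      rw [Finset.prod_mul_distrib]
      simp [ρ, cubeChar]
    have h2 : ∑ x : Cube n, ρ x * cubeChar {i} x = 2 ^ n * c {i} := by
      simp only [h1]
      rw [hprod (fun j u => (1 + c {j} * ((u : ℤ) : ℝ)) * (if j = i then ((u : ℤ) : ℝ) else 1))]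
      have : ∀ j : Fin n, (1 + c {j} * (((1 : ℤˣ) : ℤ) : ℝ)) *
            (if j = i then (((1 : ℤˣ) : ℤ) : ℝ) else 1) +
          (1 + c {j} * (((-1 : ℤˣ) : ℤ) : ℝ)) * (if j = i then (((-1 : ℤˣ) : ℤ) : ℝ) else 1)
          = 2 * if j = i then c {j} else 1 := by
        intro j
        split_ifs <;> simp <;> ring
      simp only [this]
      rw [Finset.prod_mul_distrib]
      simp
    rw [cubeCoeff]
    simp only [div_mul_eq_mul_div]
    rw [← Finset.sum_div, h2]
    field_simp

/-! ### Uniform marginals and vanishing coefficients -/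

/-- The indicator of agreement with `y` on `S` is `2 ^ (-k) * ∏ i ∈ S, (1 + y i * x i)`. In its
expansion into characters only the empty set contributes. -/
lemma IsDensity.isKWiseUniform_of_cubeCoeff {n k : ℕ} {ψ : Cube n → ℝ} (hψ : IsDensity ψ)
    (h : ∀ S ∈ lowSets n k, cubeCoeff ψ S = 0) : IsKWiseUniform k ψ := by
  refine ⟨hψ, fun S hS y => ?_⟩
  have hind : ∀ x : Cube n, (if ∀ i ∈ S, x i = y i then ψ x / 2 ^ n else 0)
      = 1 / 2 ^ k * ∑ U ∈ S.powerset, cubeChar U y * (ψ x / 2 ^ n * cubeChar U x) := by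
    intro x
    have h1 : ∑ U ∈ S.powerset, cubeChar U y * (ψ x / 2 ^ n * cubeChar U x)
        = ψ x / 2 ^ n * ∏ i ∈ S, (1 + ((y i : ℤ) : ℝ) * ((x i : ℤ) : ℝ)) := by
      rw [Finset.prod_one_add, Finset.mul_sum]
      refine Finset.sum_congr rfl fun U _ => ?_
      rw [Finset.prod_mul_distrib, cubeChar, cubeChar]
      ring
    rw [h1]
    split_ifs with hx
    · rw [Finset.prod_congr rfl (g := fun _ => (2 : ℝ)), Finset.prod_const, hS]
      · field_simp
      · intro i hi
        rw [hx i hi, ← sq, unit_coe_sq]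
        norm_num
    · push Not at hx
      obtain ⟨i, hi, hne⟩ := hx
      rw [Finset.prod_eq_zero hi, mul_zero, mul_zero]
      rw [← neg_eq_iff_eq_neg.2 (Int.units_ne_iff_eq_neg.1 hne)]
      push_cast
      linarith [unit_coe_sq (x i)]
  rw [marginalProb, Finset.sum_filter]
  simp only [hind]
  rw [← Finset.mul_sum, Finset.sum_comm, Finset.sum_eq_single ∅]
  · simp [hψ.sum_weights]
  · intro U hU hne
    rw [← Finset.mul_sum]
    have := h U (mem_lowSets.2 ⟨Finset.nonempty_iff_ne_empty.2 hne,
      hS ▸ Finset.card_le_card (Finset.mem_powerset.1 hU)⟩)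
    rw [cubeCoeff] at this
    rw [this, mul_zero]
  · simp

/-- Since `k ≤ n`, `U` extends to a set `S` of size `k`, and the coefficient at `U` is read off the
marginal on `S`. Summing over the whole cube counts each pattern on `S` exactly `N` times. -/
lemma IsKWiseUniform.cubeCoeff_eq_zero {n k : ℕ} (hkn : k ≤ n) {φ : Cube n → ℝ}
    (hφ : IsKWiseUniform k φ) {U : Finset (Fin n)} (hU : U ∈ lowSets n k) :
    cubeCoeff φ U = 0 := by
  obtain ⟨hne, hUk⟩ := mem_lowSets.1 hU
  obtain ⟨S, hUS, hS⟩ := Finset.exists_superset_card_eq hUk (by simpa using hkn)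
  let N : ℝ := ((Finset.univ : Finset (Cube n)).filter fun z => ∀ i ∈ S, z i = 1).card
  have hN : N ≠ 0 := by
    have : (1 : Cube n) ∈ (Finset.univ : Finset (Cube n)).filter fun z => ∀ i ∈ S, z i = 1 := by
      simp
    exact Nat.cast_ne_zero.2 (Finset.card_pos.2 ⟨_, this⟩).ne'
  have hfib : ∀ x : Cube n, ∑ y : Cube n, (if ∀ i ∈ S, x i = y i then cubeChar U y else 0)
      = N * cubeChar U x := by
    intro x
    rw [← Equiv.sum_comp (Equiv.mulLeft x), ← Finset.sum_filter]
    have hf : (Finset.univ : Finset (Cube n)).filter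
          (fun z => ∀ i ∈ S, x i = (Equiv.mulLeft x) z i)
        = Finset.univ.filter fun z => ∀ i ∈ S, z i = 1 := by
      ext z
      simp
    rw [hf, Finset.sum_congr rfl (g := fun _ => cubeChar U x), Finset.sum_const, nsmul_eq_mul]
    intro z hz
    refine Finset.prod_congr rfl fun i hi => ?_
    simp [(Finset.mem_filter.1 hz).2 i (hUS hi)]
  have h1 : ∑ y : Cube n, cubeChar U y * marginalProb φ S y = 0 := by
    simp only [hφ.marginal_uniform S hS]
    rw [← Finset.sum_mul, sum_cubeChar hne, zero_mul]
  have h2 : ∑ y : Cube n, cubeChar U y * marginalProb φ S y = N * cubeCoeff φ U := by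
    simp only [marginalProb, Finset.sum_filter, Finset.mul_sum, cubeCoeff]
    rw [Finset.sum_comm]
    refine Finset.sum_congr rfl fun x _ => ?_
    rw [mul_left_comm, ← hfib, Finset.mul_sum]
    refine Finset.sum_congr rfl fun y _ => ?_
    split_ifs <;> ring
  exact (mul_eq_zero.1 (h2.symm.trans h1)).resolve_left hN

/-! ### Far densities have large coefficients -/

lemma dTV_le_one {n : ℕ} {φ ψ : Cube n → ℝ} (hφ : IsDensity φ) (hψ : IsDensity ψ) :
    dTV φ ψ ≤ 1 := by
  have h : (∑ x, |φ x - ψ x|) / 2 ^ n ≤ (∑ x, (φ x + ψ x)) / 2 ^ n := by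
    gcongr with x
    exact abs_le.2 ⟨by linarith [hφ.nonneg x, hψ.nonneg x], by linarith [hφ.nonneg x, hψ.nonneg x]⟩
  rw [Finset.sum_add_distrib, add_div, hφ.mean_one, hψ.mean_one] at h
  rw [dTV]
  linarith

/-- Mixing `φ` with a density that cancels its low-degree Fourier coefficients makes it `k`-wise
uniform. -/
lemma not_isFarFromKWise_of_density {n k : ℕ} {δ : ℝ} (hδ : 0 < δ) {φ ρ : Cube n → ℝ}
    (hφ : IsDensity φ) (hρ : IsDensity ρ)
    (h : ∀ S ∈ lowSets n k, cubeCoeff ρ S = -(cubeCoeff φ S / δ)) :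
    ¬ IsFarFromKWise k δ φ := by
  intro hfar
  let ψ : Cube n → ℝ := fun x => (φ x + δ * ρ x) / (1 + δ)
  have hψ : IsDensity ψ := by
    refine ⟨fun x => div_nonneg (add_nonneg (hφ.nonneg x) (mul_nonneg hδ.le (hρ.nonneg x)))
      (by positivity), ?_⟩
    rw [← Finset.sum_div, Finset.sum_add_distrib, ← Finset.mul_sum, div_right_comm, add_div,
      mul_div_assoc, hφ.mean_one, hρ.mean_one, mul_one, div_self (by positivity)]
  have hψk : IsKWiseUniform k ψ := hψ.isKWiseUniform_of_cubeCoeff fun S hS => by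
    have : cubeCoeff ψ S = (cubeCoeff φ S + δ * cubeCoeff ρ S) / (1 + δ) := by
      simp only [cubeCoeff]
      rw [Finset.mul_sum, ← Finset.sum_add_distrib, Finset.sum_div]
      refine Finset.sum_congr rfl fun x _ => ?_
      simp only [ψ]
      ring
    rw [this, h S hS]
    field_simp
    ring
  have hd : dTV φ ψ = δ / (1 + δ) * dTV φ ρ := by
    have : ∀ x, |φ x - ψ x| = δ / (1 + δ) * |φ x - ρ x| := by
      intro x
      have hx : φ x - ψ x = δ / (1 + δ) * (φ x - ρ x) := by
        simp only [ψ]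
        field_simp
        ring
      rw [hx, abs_mul, abs_of_pos (show 0 < δ / (1 + δ) by positivity)]
    simp only [dTV, this, ← Finset.mul_sum]
    ring
  have h1 : dTV φ ψ ≤ δ := by
    rw [hd]
    calc δ / (1 + δ) * dTV φ ρ ≤ δ / (1 + δ) * 1 := by
          gcongr
          exact dTV_le_one hφ hρ
      _ ≤ δ := by
          rw [mul_one]
          exact div_le_self hδ.le (by linarith)
  exact absurd (hfar ψ hψk) (not_lt.2 h1)

lemma IsFarFromKWise.lt_sum_cubeCoeff_sq {n k : ℕ} {δ : ℝ} (hδ : 0 < δ) {φ : Cube n → ℝ}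
    (hφ : IsDensity φ) (hfar : IsFarFromKWise k δ φ) :
    δ ^ 2 < 9 ^ k * ∑ S ∈ lowSets n k, cubeCoeff φ S ^ 2 := by
  by_contra hle
  obtain ⟨ρ, hρ, h⟩ := exists_density_of_sum_sq_le (k := k)
    (fun S => -(cubeCoeff φ S / δ)) (by
      simp only [neg_sq, div_pow]
      rw [← Finset.sum_div, ← mul_div_assoc, div_le_one (by positivity)]
      exact not_lt.1 hle)
  exact not_isFarFromKWise_of_density hδ hφ hρ h hfar

lemma IsFarFromKWise.exists_lt_abs_cubeCoeff {n : ℕ} {δ : ℝ} (hδ : 0 < δ) {φ : Cube n → ℝ}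
    (hφ : IsDensity φ) (hfar : IsFarFromKWise 1 δ φ) :
    ∃ S ∈ lowSets n 1, δ < |cubeCoeff φ S| := by
  by_contra! hle
  obtain ⟨ρ, hρ, h⟩ := exists_density_of_abs_le
    (fun S => -(cubeCoeff φ S / δ)) (fun S hS => by
      rw [abs_neg, abs_div, abs_of_pos hδ, div_le_one hδ]
      exact hle S hS)
  exact not_isFarFromKWise_of_density hδ hφ hρ h hfar

/-! ### Moments of sums of independent samples -/

lemma sum_prod_mul_prod {α : Type*} [Fintype α] {m : ℕ} (w : α → ℝ) (g : Fin m → α → ℝ) :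
    ∑ X : Fin m → α, (∏ s, w (X s)) * ∏ s, g s (X s) = ∏ s, ∑ x, w x * g s x := by
  simp only [← Finset.prod_mul_distrib]
  exact (Fintype.prod_sum fun s x => w x * g s x).symm

lemma sum_prod_weights {α : Type*} [Fintype α] {m : ℕ} {w : α → ℝ} (hw : ∑ x, w x = 1) :
    ∑ X : Fin m → α, ∏ s, w (X s) = 1 := by
  have := sum_prod_mul_prod (m := m) w fun _ _ => 1
  simpa [hw] using this

/-- The variance of a sum of independent centered variables is the sum of the variances. -/
lemma sum_prod_mul_sum_sq {α : Type*} [Fintype α] {m : ℕ} {w : α → ℝ} (hw : ∑ x, w x = 1)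
    {a : α → ℝ} (ha : ∑ x, w x * a x = 0) :
    ∑ X : Fin m → α, (∏ s, w (X s)) * (∑ s, a (X s)) ^ 2 = m * ∑ x, w x * a x ^ 2 := by
  have hpair : ∀ s t : Fin m, ∑ X : Fin m → α, (∏ r, w (X r)) * (a (X s) * a (X t))
      = if s = t then ∑ x, w x * a x ^ 2 else 0 := by
    intro s t
    have hX : ∀ X : Fin m → α, a (X s) * a (X t)
        = ∏ r, ((if r = s then a (X r) else 1) * (if r = t then a (X r) else 1)) := by
      intro X
      rw [Finset.prod_mul_distrib]
      simp
    simp only [hX]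
    rw [sum_prod_mul_prod w fun r x => (if r = s then a x else 1) * (if r = t then a x else 1)]
    split_ifs with h
    · subst h
      rw [Finset.prod_eq_single s]
      · simp [sq]
      · intro r _ hr
        simp [hr, hw]
      · simp
    · refine Finset.prod_eq_zero (Finset.mem_univ s) ?_
      simp [h, ha]
  calc ∑ X : Fin m → α, (∏ s, w (X s)) * (∑ s, a (X s)) ^ 2
      = ∑ X : Fin m → α, ∑ s, ∑ t, (∏ r, w (X r)) * (a (X s) * a (X t)) := by
        refine Finset.sum_congr rfl fun X _ => ?_
        rw [sq, Finset.sum_mul_sum, Finset.mul_sum]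
        simp only [Finset.mul_sum]
    _ = ∑ s : Fin m, ∑ t : Fin m, ∑ X : Fin m → α, (∏ r, w (X r)) * (a (X s) * a (X t)) := by
        rw [Finset.sum_comm]
        exact Finset.sum_congr rfl fun s _ => Finset.sum_comm
    _ = m * ∑ x, w x * a x ^ 2 := by simp [hpair]

lemma sum_weights_mul_exp_le {α : Type*} [Fintype α] {w : α → ℝ} (hw0 : ∀ x, 0 ≤ w x)
    (hw : ∑ x, w x = 1) {a : α → ℝ} (ha : ∑ x, w x * a x = 0) (hb : ∀ x, |a x| ≤ 2)
    {t : ℝ} (ht : |t| ≤ 1 / 2) :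
    ∑ x, w x * Real.exp (t * a x) ≤ Real.exp (4 * t ^ 2) := by
  -- From `exp y ≤ 1 + y + y ^ 2` for `|y| ≤ 1`; the linear term averages to zero.
  have hexp : ∀ x, Real.exp (t * a x) ≤ 1 + 4 * t ^ 2 + t * a x := by
    intro x
    have h1 : |t * a x| ≤ 1 := by
      rw [abs_mul]
      calc |t| * |a x| ≤ 1 / 2 * 2 := mul_le_mul ht (hb x) (abs_nonneg _) (by norm_num)
        _ = 1 := by norm_num
    have h2 := (abs_le.1 (Real.abs_exp_sub_one_sub_id_le h1)).2
    have h3 : (t * a x) ^ 2 ≤ t ^ 2 * 2 ^ 2 := by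
      rw [mul_pow]
      exact mul_le_mul_of_nonneg_left (sq_le_sq.2 (by rw [abs_two]; exact hb x)) (sq_nonneg t)
    linarith
  calc ∑ x, w x * Real.exp (t * a x) ≤ ∑ x, w x * (1 + 4 * t ^ 2 + t * a x) :=
        Finset.sum_le_sum fun x _ => mul_le_mul_of_nonneg_left (hexp x) (hw0 x)
    _ = (∑ x, w x) * (1 + 4 * t ^ 2) + t * ∑ x, w x * a x := by
        rw [Finset.sum_mul, Finset.mul_sum, ← Finset.sum_add_distrib]
        exact Finset.sum_congr rfl fun x _ => by ring
    _ = 4 * t ^ 2 + 1 := by rw [hw, ha]; ring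
    _ ≤ Real.exp (4 * t ^ 2) := Real.add_one_le_exp _

lemma sum_prod_mul_exp_le {α : Type*} [Fintype α] {m : ℕ} {w : α → ℝ} (hw0 : ∀ x, 0 ≤ w x)
    (hw : ∑ x, w x = 1) {a : α → ℝ} (ha : ∑ x, w x * a x = 0) (hb : ∀ x, |a x| ≤ 2)
    {t : ℝ} (ht : |t| ≤ 1 / 2) :
    ∑ X : Fin m → α, (∏ s, w (X s)) * Real.exp (t * ∑ s, a (X s))
      ≤ Real.exp (4 * t ^ 2 * m) := by
  simp only [Finset.mul_sum, Real.exp_sum]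
  rw [sum_prod_mul_prod w fun _ x => Real.exp (t * a x), Finset.prod_const, Finset.card_univ,
    Fintype.card_fin, mul_comm, Real.exp_nat_mul]
  refine pow_le_pow_left₀ (Finset.sum_nonneg fun x _ => mul_nonneg (hw0 x) (Real.exp_pos _).le) ?_ m
  exact sum_weights_mul_exp_le hw0 hw ha hb ht

/-- Markov's inequality for the output of a decision rule. -/
lemma one_sub_le_outputProb {n m : ℕ} {φ : Cube n → ℝ} (hφ : IsDensity φ)
    {T : (Fin m → Cube n) → Bool} {b : Bool} {η : ℝ} (G : (Fin m → Cube n) → ℝ)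
    (hG0 : ∀ X, 0 ≤ G X) (hG : ∀ X, T X ≠ b → 1 ≤ G X)
    (hη : ∑ X, (∏ s, φ (X s) / 2 ^ n) * G X ≤ η) : 1 - η ≤ outputProb φ T b := by
  have hP : ∀ X : Fin m → Cube n, 0 ≤ ∏ s, φ (X s) / 2 ^ n := fun X =>
    Finset.prod_nonneg fun s _ => div_nonneg (hφ.nonneg _) (by positivity)
  calc 1 - η ≤ ∑ X, (∏ s, φ (X s) / 2 ^ n) * (1 - G X) := by
        simp only [mul_sub, mul_one, Finset.sum_sub_distrib]
        rw [sum_prod_weights (m := m) hφ.sum_weights]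
        linarith
    _ ≤ ∑ X, if T X = b then ∏ s, φ (X s) / 2 ^ n else 0 := by
        refine Finset.sum_le_sum fun X _ => ?_
        split_ifs with h
        · exact mul_le_of_le_one_right (hP X) (by linarith [hG0 X])
        · exact mul_nonpos_of_nonneg_of_nonpos (hP X) (by linarith [hG X h])
    _ = outputProb φ T b := (Finset.sum_filter _ _).symm

/-! ### Empirical coefficients and the two testers -/

/-- The empirical Fourier coefficient at `S` of the sample `X`. -/
noncomputable def empiricalCoeff {n m : ℕ} (X : Fin m → Cube n) (S : Finset (Fin n)) : ℝ :=
  (∑ s, cubeChar S (X s)) / m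

lemma empiricalCoeff_sub {n m : ℕ} (hm : 0 < m) (X : Fin m → Cube n) (S : Finset (Fin n))
    (μ : ℝ) : empiricalCoeff X S - μ = (∑ s, (cubeChar S (X s) - μ)) / m := by
  have : (m : ℝ) ≠ 0 := by positivity
  rw [empiricalCoeff, Finset.sum_sub_distrib]
  simp
  field_simp

lemma IsDensity.sum_mul_cubeChar_sub {n : ℕ} {φ : Cube n → ℝ} (hφ : IsDensity φ)
    (S : Finset (Fin n)) : ∑ x, φ x / 2 ^ n * (cubeChar S x - cubeCoeff φ S) = 0 := by
  simp only [mul_sub, Finset.sum_sub_distrib]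
  rw [← Finset.sum_mul, hφ.sum_weights, one_mul, cubeCoeff, sub_self]

lemma IsDensity.abs_cubeCoeff_le {n : ℕ} {φ : Cube n → ℝ} (hφ : IsDensity φ)
    (S : Finset (Fin n)) : |cubeCoeff φ S| ≤ 1 := by
  rw [← hφ.sum_weights]
  refine (Finset.abs_sum_le_sum_abs _ _).trans (le_of_eq (Finset.sum_congr rfl fun x _ => ?_))
  rw [abs_mul, abs_cubeChar, mul_one,
    abs_of_nonneg (div_nonneg (hφ.nonneg x) (by positivity))]

/-- A character takes values `±1`, so its variance is one minus its squared mean, at most `1`. -/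
lemma IsDensity.sum_empiricalCoeff_sub_sq_le {n m : ℕ} (hm : 0 < m) {φ : Cube n → ℝ}
    (hφ : IsDensity φ) (S : Finset (Fin n)) :
    ∑ X : Fin m → Cube n, (∏ s, φ (X s) / 2 ^ n) * (empiricalCoeff X S - cubeCoeff φ S) ^ 2
      ≤ 1 / m := by
  have hm' : (0 : ℝ) < m := by positivity
  have h1 := sum_prod_mul_sum_sq (m := m) hφ.sum_weights (hφ.sum_mul_cubeChar_sub S)
  have h2 : ∑ x, φ x / 2 ^ n * (cubeChar S x - cubeCoeff φ S) ^ 2 ≤ 1 := by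
    have h3 : ∀ x, φ x / 2 ^ n * (cubeChar S x - cubeCoeff φ S) ^ 2
        = φ x / 2 ^ n * (1 + cubeCoeff φ S ^ 2)
          - 2 * cubeCoeff φ S * (φ x / 2 ^ n * cubeChar S x) := by
      intro x
      linear_combination (φ x / 2 ^ n) * cubeChar_sq S x
    simp only [h3]
    rw [Finset.sum_sub_distrib, ← Finset.sum_mul, ← Finset.mul_sum, hφ.sum_weights, ← cubeCoeff]
    nlinarith [sq_nonneg (cubeCoeff φ S)]
  simp only [empiricalCoeff_sub hm, div_pow, ← mul_div_assoc]
  rw [← Finset.sum_div, h1, div_le_div_iff₀ (by positivity) hm']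
  nlinarith

/-- Comparing the total squared weight of the low-degree empirical coefficients with a threshold
tests `k`-wise uniformity. -/
lemma hasTester_of_card_lowSets_le {n k m : ℕ} (hkn : k ≤ n) {δ η : ℝ} (hδ : 0 < δ)
    (hm : 0 < m) (h : 4 * 9 ^ k * (lowSets n k).card ≤ η * (δ ^ 2 * m)) :
    HasTester n k δ η m := by
  classical
  -- With threshold `δ ^ 2 / (4 * 9 ^ k)`, any wrong answer forces the squared error `D` up to the
  -- same threshold: directly if `φ` is `k`-wise uniform, and by `c ^ 2 ≤ 2 * e ^ 2 + 2 * (e - c) ^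
  -- 2` if it is far.
  let T : (Fin m → Cube n) → Bool := fun X =>
    decide (4 * 9 ^ k * ∑ S ∈ lowSets n k, empiricalCoeff X S ^ 2 ≤ δ ^ 2)
  let D : (Cube n → ℝ) → (Fin m → Cube n) → ℝ := fun φ X =>
    ∑ S ∈ lowSets n k, (empiricalCoeff X S - cubeCoeff φ S) ^ 2
  have hD0 : ∀ φ X, 0 ≤ D φ X := fun φ X => Finset.sum_nonneg fun S _ => sq_nonneg _
  have hmean : ∀ φ : Cube n → ℝ, IsDensity φ →
      ∑ X : Fin m → Cube n, (∏ s, φ (X s) / 2 ^ n) * (4 * 9 ^ k / δ ^ 2 * D φ X) ≤ η := by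
    intro φ hφ
    have hm' : (0 : ℝ) < m := by positivity
    calc ∑ X : Fin m → Cube n, (∏ s, φ (X s) / 2 ^ n) * (4 * 9 ^ k / δ ^ 2 * D φ X)
        = 4 * 9 ^ k / δ ^ 2 * ∑ S ∈ lowSets n k, ∑ X : Fin m → Cube n,
            (∏ s, φ (X s) / 2 ^ n) * (empiricalCoeff X S - cubeCoeff φ S) ^ 2 := by
          simp only [D]
          rw [Finset.sum_comm, Finset.mul_sum]
          refine Finset.sum_congr rfl fun X _ => ?_
          rw [← Finset.mul_sum]
          ring
      _ ≤ 4 * 9 ^ k / δ ^ 2 * ∑ S ∈ lowSets n k, 1 / (m : ℝ) := by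
          gcongr with S
          exact hφ.sum_empiricalCoeff_sub_sq_le hm S
      _ = 4 * 9 ^ k * (lowSets n k).card / (δ ^ 2 * m) := by
          rw [Finset.sum_const, nsmul_eq_mul]
          field_simp
      _ ≤ η := by rwa [div_le_iff₀ (by positivity)]
  have hone : ∀ φ X, δ ^ 2 ≤ 4 * 9 ^ k * D φ X → 1 ≤ 4 * 9 ^ k / δ ^ 2 * D φ X := by
    intro φ X hle
    rw [div_mul_eq_mul_div, le_div_iff₀ (by positivity)]
    linarith
  refine ⟨T, ⟨fun φ hφ => ?_, fun φ hφ hfar => ?_⟩⟩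
  · refine one_sub_le_outputProb hφ.isDensity (fun X => 4 * 9 ^ k / δ ^ 2 * D φ X)
      (fun X => mul_nonneg (by positivity) (hD0 φ X)) (fun X hX => hone φ X ?_)
      (hmean φ hφ.isDensity)
    have hDX : D φ X = ∑ S ∈ lowSets n k, empiricalCoeff X S ^ 2 :=
      Finset.sum_congr rfl fun S hS => by rw [hφ.cubeCoeff_eq_zero hkn hS, sub_zero]
    rw [hDX]
    simp only [T, ne_eq, decide_eq_true_eq, not_le] at hX
    exact hX.le
  · refine one_sub_le_outputProb hφ (fun X => 4 * 9 ^ k / δ ^ 2 * D φ X)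
      (fun X => mul_nonneg (by positivity) (hD0 φ X)) (fun X hX => hone φ X ?_) (hmean φ hφ)
    simp only [T, ne_eq, decide_eq_false_iff_not, not_not] at hX
    have hlt := hfar.lt_sum_cubeCoeff_sq hδ hφ
    have htri : ∑ S ∈ lowSets n k, cubeCoeff φ S ^ 2
        ≤ 2 * (∑ S ∈ lowSets n k, empiricalCoeff X S ^ 2) + 2 * D φ X := by
      simp only [D]
      rw [Finset.mul_sum, Finset.mul_sum, ← Finset.sum_add_distrib]
      refine Finset.sum_le_sum fun S _ => ?_
      nlinarith [sq_nonneg (2 * empiricalCoeff X S - cubeCoeff φ S)]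
    have := mul_le_mul_of_nonneg_left htri (show (0 : ℝ) ≤ 9 ^ k by positivity)
    linarith

/-- Comparing each first-order empirical coefficient with a threshold tests `1`-wise
uniformity. -/
lemma hasTester_one_of_exp_le {n m : ℕ} (hn : 1 ≤ n) {δ η : ℝ} (hδ : 0 < δ) (hδ1 : δ ≤ 1)
    (hm : 0 < m) (h : 2 * n * Real.exp (-(δ ^ 2 * m / 64)) ≤ η) :
    HasTester n 1 δ η m := by
  classical
  have hm' : (0 : ℝ) < m := by positivity
  let T : (Fin m → Cube n) → Bool := fun X =>
    decide (∀ S ∈ lowSets n 1, |empiricalCoeff X S| ≤ δ / 2)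
  let A : (Cube n → ℝ) → Finset (Fin n) → (Fin m → Cube n) → ℝ := fun φ S X =>
    ∑ s, (cubeChar S (X s) - cubeCoeff φ S)
  -- Two-sided Chernoff bound for deviations `δ / 2`, summed over coordinates. The parameter `t = δ
  -- / 16` minimizes `4 * t ^ 2 - t * δ / 2`.
  let G : (Cube n → ℝ) → (Fin m → Cube n) → ℝ := fun φ X => ∑ S ∈ lowSets n 1,
    (Real.exp (δ / 16 * A φ S X) + Real.exp (-(δ / 16) * A φ S X)) * Real.exp (-(δ ^ 2 * m / 32))
  have hterm : ∀ φ S X, 0 ≤ (Real.exp (δ / 16 * A φ S X) + Real.exp (-(δ / 16) * A φ S X)) *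
      Real.exp (-(δ ^ 2 * m / 32)) := fun φ S X => by positivity
  have hG0 : ∀ φ X, 0 ≤ G φ X := fun φ X => Finset.sum_nonneg fun S _ => hterm φ S X
  have hcard : (lowSets n 1).card = n := by
    have : lowSets n 1 = Finset.univ.powersetCard 1 := by
      ext S
      rw [mem_lowSets, Finset.mem_powersetCard, ← Finset.card_pos]
      simp only [Finset.subset_univ, true_and]
      omega
    rw [this, Finset.card_powersetCard]
    simp
  have hmean : ∀ φ : Cube n → ℝ, IsDensity φ →
      ∑ X : Fin m → Cube n, (∏ s, φ (X s) / 2 ^ n) * G φ X ≤ η := by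
    intro φ hφ
    have hb : ∀ S x, |cubeChar S x - cubeCoeff φ S| ≤ 2 := fun S x => by
      refine (abs_sub _ _).trans ?_
      rw [abs_cubeChar]
      linarith [hφ.abs_cubeCoeff_le S]
    have hE : ∀ S (t : ℝ), |t| = δ / 16 →
        ∑ X : Fin m → Cube n, (∏ s, φ (X s) / 2 ^ n) * Real.exp (t * A φ S X)
          ≤ Real.exp (δ ^ 2 * m / 64) := by
      intro S t ht
      have := sum_prod_mul_exp_le (m := m) (w := fun x => φ x / 2 ^ n)
        (fun x => div_nonneg (hφ.nonneg x) (by positivity)) hφ.sum_weights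
        (hφ.sum_mul_cubeChar_sub S) (hb S) (t := t) (by rw [ht]; linarith)
      rwa [← sq_abs t, ht, show 4 * (δ / 16) ^ 2 * (m : ℝ) = δ ^ 2 * m / 64 by ring] at this
    calc ∑ X : Fin m → Cube n, (∏ s, φ (X s) / 2 ^ n) * G φ X
        = ∑ S ∈ lowSets n 1,
            (∑ X : Fin m → Cube n, (∏ s, φ (X s) / 2 ^ n) * Real.exp (δ / 16 * A φ S X)
            + ∑ X : Fin m → Cube n, (∏ s, φ (X s) / 2 ^ n) * Real.exp (-(δ / 16) * A φ S X))
            * Real.exp (-(δ ^ 2 * m / 32)) := by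
          simp only [G, Finset.mul_sum]
          rw [Finset.sum_comm]
          refine Finset.sum_congr rfl fun S _ => ?_
          rw [← Finset.sum_add_distrib, Finset.sum_mul]
          exact Finset.sum_congr rfl fun X _ => by ring
      _ ≤ ∑ S ∈ lowSets n 1, (Real.exp (δ ^ 2 * m / 64) + Real.exp (δ ^ 2 * m / 64))
            * Real.exp (-(δ ^ 2 * m / 32)) := by
          gcongr with S
          · exact hE S _ (abs_of_pos (by positivity))
          · exact hE S _ (by rw [abs_neg, abs_of_pos (by positivity)])
      _ = 2 * n * Real.exp (-(δ ^ 2 * m / 64)) := by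
          rw [Finset.sum_const, hcard, nsmul_eq_mul, ← two_mul,
            show -(δ ^ 2 * m / 64) = δ ^ 2 * m / 64 + -(δ ^ 2 * m / 32) by ring, Real.exp_add]
          ring
      _ ≤ η := h
  have hone : ∀ φ X, ∀ S ∈ lowSets n 1, δ / 2 ≤ |empiricalCoeff X S - cubeCoeff φ S| →
      1 ≤ G φ X := by
    intro φ X S hS hle
    refine le_trans ?_ (Finset.single_le_sum (fun S _ => hterm φ S X) hS)
    rw [empiricalCoeff_sub hm, abs_div, abs_of_pos hm', le_div_iff₀ hm'] at hle
    rw [add_mul, ← Real.exp_add, ← Real.exp_add]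
    rcases le_abs.1 hle with hle | hle
    · refine le_add_of_le_of_nonneg (Real.one_le_exp ?_) (Real.exp_pos _).le
      have := mul_le_mul_of_nonneg_left hle (show 0 ≤ δ / 16 by positivity)
      change _ ≤ δ / 16 * A φ S X at this
      linarith
    · refine le_add_of_nonneg_of_le (Real.exp_pos _).le (Real.one_le_exp ?_)
      have := mul_le_mul_of_nonneg_left hle (show 0 ≤ δ / 16 by positivity)
      change _ ≤ δ / 16 * -A φ S X at this
      linarith
  refine ⟨T, ⟨fun φ hφ => ?_, fun φ hφ hfar => ?_⟩⟩
  · refine one_sub_le_outputProb hφ.isDensity (G φ) (hG0 φ) (fun X hX => ?_)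
      (hmean φ hφ.isDensity)
    simp only [T, ne_eq, decide_eq_true_eq] at hX
    push Not at hX
    obtain ⟨S, hS, hlt⟩ := hX
    exact hone φ X S hS (by rw [hφ.cubeCoeff_eq_zero hn hS, sub_zero]; exact hlt.le)
  · refine one_sub_le_outputProb hφ (G φ) (hG0 φ) (fun X hX => ?_) (hmean φ hφ)
    simp only [T, ne_eq, decide_eq_false_iff_not, not_not] at hX
    obtain ⟨S, hS, hlt⟩ := hfar.exists_lt_abs_cubeCoeff hδ hφ
    refine hone φ X S hS ?_
    have := abs_sub_abs_le_abs_sub (cubeCoeff φ S) (empiricalCoeff X S)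
    rw [abs_sub_comm]
    linarith [hX S hS]

/-! ### Sample counts -/

lemma isKWiseUniform_one (n k : ℕ) : IsKWiseUniform k (fun _ : Cube n => (1 : ℝ)) := by
  have hd : IsDensity (fun _ : Cube n => (1 : ℝ)) := ⟨fun _ => zero_le_one, cubeMean_const 1⟩
  refine hd.isKWiseUniform_of_cubeCoeff fun S hS => ?_
  rw [cubeCoeff, ← Finset.mul_sum, sum_cubeChar (mem_lowSets.1 hS).1, mul_zero]

/-- No distribution is at distance more than `1`, so no samples are needed for `δ ≥ 1`. -/
lemma hasTester_zero {n k : ℕ} {δ η : ℝ} (hδ : 1 ≤ δ) (hη : 0 ≤ η) : HasTester n k δ η 0 := by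
  refine ⟨fun _ => true, ⟨fun φ hφ => ?_, fun φ hφ hfar => ?_⟩⟩
  · exact one_sub_le_outputProb hφ.isDensity (fun _ => 0) (fun _ => le_rfl) (by simp) (by simpa)
  · have h1 := hfar _ (isKWiseUniform_one n k)
    have h2 := dTV_le_one hφ (isKWiseUniform_one n k).isDensity
    linarith

/-- Give `S` the weight `q ^ S.card` with `q = k / n ≤ 1`. Low sets weigh at least `q ^ k` each, and
all sets together weigh `(1 + q) ^ n ≤ exp k`. -/
lemma card_lowSets_mul_pow_le {n k : ℕ} (hk : 1 ≤ k) (hkn : k ≤ n) :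
    ((lowSets n k).card : ℝ) * (k : ℝ) ^ k ≤ (3 * n) ^ k := by
  have hn : (0 : ℝ) < n := by exact_mod_cast hk.trans hkn
  have hk0 : (0 : ℝ) < k := by exact_mod_cast hk
  have hq1 : (k : ℝ) / n ≤ 1 := (div_le_one hn).2 (by exact_mod_cast hkn)
  have h1 : ((lowSets n k).card : ℝ) * ((k : ℝ) / n) ^ k ≤ 3 ^ k := by
    calc ((lowSets n k).card : ℝ) * ((k : ℝ) / n) ^ k
        = ∑ S ∈ lowSets n k, ((k : ℝ) / n) ^ k := by rw [Finset.sum_const, nsmul_eq_mul]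
      _ ≤ ∑ S ∈ lowSets n k, ((k : ℝ) / n) ^ S.card := by
          refine Finset.sum_le_sum fun S hS => ?_
          exact pow_le_pow_of_le_one (by positivity) hq1 (mem_lowSets.1 hS).2
      _ ≤ ∑ S ∈ (Finset.univ : Finset (Fin n)).powerset, ∏ _i ∈ S, ((k : ℝ) / n) := by
          simp only [Finset.prod_const, Finset.powerset_univ]
          exact Finset.sum_le_sum_of_subset_of_nonneg (Finset.subset_univ _)
            fun S _ _ => by positivity
      _ = (1 + (k : ℝ) / n) ^ n := by rw [← Finset.prod_one_add]; simp
      _ ≤ Real.exp ((k : ℝ) / n) ^ n := by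
          gcongr
          rw [add_comm]
          exact Real.add_one_le_exp _
      _ = Real.exp 1 ^ k := by
          rw [← Real.exp_nat_mul, ← Real.exp_nat_mul, mul_div_cancel₀ _ hn.ne', mul_one]
      _ ≤ 3 ^ k := by
          gcongr
          exact Real.exp_one_lt_three.le
  rw [div_pow, ← mul_div_assoc, div_le_iff₀ (by positivity)] at h1
  rwa [mul_pow]

lemma exists_hasTester_le {n k : ℕ} (hk : 1 ≤ k) (hkn : k ≤ n) {δ η C : ℝ} (hδ : 0 < δ)
    (hη : 0 < η) (hC : ((4 / η + 1) * 27) ^ 2 ≤ C) :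
    ∃ m : ℕ, (m : ℝ) ≤ (C / (k : ℝ)) ^ ((k : ℝ) / 2) * ((n : ℝ) ^ k / δ ^ 2) ∧
      HasTester n k δ η m := by
  have hk0 : (0 : ℝ) < k := by exact_mod_cast hk
  have hn : (0 : ℝ) < n := by exact_mod_cast hk.trans hkn
  have hC0 : 0 ≤ C := (sq_nonneg _).trans hC
  rcases le_or_gt 1 δ with hδ1 | hδ1
  · refine ⟨0, ?_, hasTester_zero hδ1 hη.le⟩
    rw [Nat.cast_zero]
    positivity
  set M : ℝ := ((lowSets n k).card : ℝ)
  set a : ℝ := 4 * 9 ^ k * M / η with ha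
  have ha0 : 0 < a / δ ^ 2 := by
    have : (0 : ℝ) < M := by
      obtain ⟨S, -, hS⟩ := Finset.exists_superset_card_eq (s := (∅ : Finset (Fin n)))
        (n := k) (by simp) (by simpa using hkn)
      exact Nat.cast_pos.2
        (Finset.card_pos.2 ⟨S, mem_lowSets.2 ⟨Finset.card_pos.1 (by omega), hS.le⟩⟩)
    positivity
  refine ⟨⌈a / δ ^ 2⌉₊, ?_, hasTester_of_card_lowSets_le hkn hδ (Nat.ceil_pos.2 ha0) ?_⟩
  · have hroot : (C / (k : ℝ)) ^ ((k : ℝ) / 2) = √(C / k) ^ k := by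
      rw [Real.sqrt_eq_rpow, ← Real.rpow_natCast, ← Real.rpow_mul (by positivity)]
      ring_nf
    have hk1 : (1 : ℝ) ≤ √k := Real.one_le_sqrt.2 (by exact_mod_cast hk)
    have hbase : (4 / η + 1) * 27 / √k ≤ √(C / k) := by
      rw [Real.sqrt_div hC0]
      gcongr
      exact Real.le_sqrt_of_sq_le hC
    -- The cardinality bound has `k ^ k` in the denominator; only `√k ^ k` is needed.
    have hsk : √(k : ℝ) ≤ k := by
      nlinarith [Real.sq_sqrt hk0.le]
    have hnk : (√(k : ℝ)) ^ k ≤ n ^ k := by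
      gcongr
      exact hsk.trans (by exact_mod_cast hkn)
    have hMle : M ≤ 3 ^ k * n ^ k / √(k : ℝ) ^ k := by
      rw [le_div_iff₀ (by positivity), ← mul_pow]
      refine le_trans ?_ (card_lowSets_mul_pow_le hk hkn)
      gcongr
    -- Here `27 = 9 * 3` joins the hypercontractive and counting constants, and the `1` in `4 / η +
    -- 1` absorbs rounding up, which costs at most `1 / δ ^ 2` as `δ < 1`.
    have hmain : a + 1 ≤ √(C / k) ^ k * n ^ k := by
      have h27 : (1 : ℝ) ≤ 27 ^ k := one_le_pow₀ (by norm_num)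
      calc a + 1 ≤ 4 * 9 ^ k * (3 ^ k * n ^ k / √(k : ℝ) ^ k) / η
              + 27 ^ k * (n ^ k / √(k : ℝ) ^ k) := by
            refine add_le_add (by rw [ha]; gcongr) (one_le_mul_of_one_le_of_one_le h27 ?_)
            rwa [one_le_div (by positivity)]
        _ = (4 / η + 1) * 27 ^ k * (n ^ k / √(k : ℝ) ^ k) := by
            rw [show (27 : ℝ) = 9 * 3 by norm_num, mul_pow]
            ring
        _ ≤ (4 / η + 1) ^ k * 27 ^ k * (n ^ k / √(k : ℝ) ^ k) := by
            gcongr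
            exact le_self_pow₀ (by linarith [show 0 < 4 / η by positivity]) (by omega)
        _ = ((4 / η + 1) * 27 / √k) ^ k * n ^ k := by
            rw [div_pow, mul_pow]
            ring
        _ ≤ √(C / k) ^ k * n ^ k := by gcongr
    rw [hroot, ← mul_div_assoc]
    have hδ2 : δ ^ 2 ≤ 1 := pow_le_one₀ hδ.le hδ1.le
    calc (⌈a / δ ^ 2⌉₊ : ℝ) ≤ a / δ ^ 2 + 1 := (Nat.ceil_lt_add_one ha0.le).le
      _ ≤ a / δ ^ 2 + 1 / δ ^ 2 := by
          gcongr
          exact one_le_one_div (by positivity) hδ2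
      _ = (a + 1) / δ ^ 2 := by ring
      _ ≤ _ := by gcongr
  · have := Nat.le_ceil (a / δ ^ 2)
    rw [div_le_iff₀ (by positivity)] at this
    have h2 : 4 * 9 ^ k * M = η * a := by
      rw [ha]
      field_simp
    rw [h2]
    nlinarith

lemma exists_hasTester_one_le {n : ℕ} (hn : 2 ≤ n) {δ η C : ℝ} (hδ : 0 < δ)
    (hη : 0 < η) (hη1 : η < 1)
    (hC : 64 * (1 + Real.log (2 / η) / Real.log 2) + 1 / Real.log 2 ≤ C) :
    ∃ m : ℕ, (m : ℝ) ≤ C * (Real.log (n : ℝ) / δ ^ 2) ∧ HasTester n 1 δ η m := by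
  have hl2 : 0 < Real.log 2 := Real.log_pos one_lt_two
  have hn0 : (0 : ℝ) < n := by positivity
  have hln : Real.log 2 ≤ Real.log n := Real.log_le_log two_pos (by exact_mod_cast hn)
  have hlη : 0 ≤ Real.log (2 / η) := Real.log_nonneg (by rw [le_div_iff₀ hη]; linarith)
  have hC0 : 0 ≤ C := le_trans (by positivity) hC
  rcases le_or_gt 1 δ with hδ1 | hδ1
  · refine ⟨0, ?_, hasTester_zero hδ1 hη.le⟩
    rw [Nat.cast_zero]
    have := hl2.le.trans hln
    positivity
  have hL : 0 < Real.log n := hl2.trans_le hln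
  -- Solves `2 * n * exp (-a / 64) = η`. As `log n ≥ log 2`, the `η` term and the rounding are
  -- absorbed into a multiple of `log n`.
  set a : ℝ := 64 * (Real.log n + Real.log (2 / η)) with ha
  have ha0 : 0 < a / δ ^ 2 := by positivity
  refine ⟨⌈a / δ ^ 2⌉₊, ?_,
    hasTester_one_of_exp_le (by omega) hδ hδ1.le (Nat.ceil_pos.2 ha0) ?_⟩
  · have hδ2 : δ ^ 2 ≤ 1 := pow_le_one₀ hδ.le hδ1.le
    have hone : 1 ≤ Real.log n / Real.log 2 := (one_le_div hl2).2 hln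
    have hmain : a + 1 ≤ C * Real.log n := by
      have h1 : Real.log (2 / η) * 1 ≤ Real.log (2 / η) * (Real.log n / Real.log 2) := by gcongr
      calc a + 1 ≤ 64 * (Real.log n + Real.log (2 / η) * (Real.log n / Real.log 2))
            + Real.log n / Real.log 2 := by linarith
        _ = (64 * (1 + Real.log (2 / η) / Real.log 2) + 1 / Real.log 2) * Real.log n := by ring
        _ ≤ C * Real.log n := by gcongr
    calc (⌈a / δ ^ 2⌉₊ : ℝ) ≤ a / δ ^ 2 + 1 := (Nat.ceil_lt_add_one ha0.le).le
      _ ≤ a / δ ^ 2 + 1 / δ ^ 2 := by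
          gcongr
          exact one_le_one_div (by positivity) hδ2
      _ = (a + 1) / δ ^ 2 := by ring
      _ ≤ C * Real.log n / δ ^ 2 := by gcongr
      _ = _ := by ring
  · have h1 := Nat.le_ceil (a / δ ^ 2)
    rw [div_le_iff₀ (by positivity), ha] at h1
    have h2 : Real.log (2 * n / η) ≤ δ ^ 2 * ⌈a / δ ^ 2⌉₊ / 64 := by
      rw [show 2 * (n : ℝ) / η = n * (2 / η) by ring, Real.log_mul hn0.ne' (by positivity)]
      linarith
    rw [Real.log_le_iff_le_exp (by positivity), div_le_iff₀ hη] at h2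
    rw [Real.exp_neg, ← div_eq_mul_inv, div_le_iff₀ (Real.exp_pos _)]
    linarith

theorem theorem3 (η : ℝ) (hη0 : 0 < η) (hη1 : η < 1) :
    ∃ C : ℝ, 0 < C ∧
      (∀ n k : ℕ, 1 ≤ k → k ≤ n → ∀ δ : ℝ, 0 < δ →
        ∃ m : ℕ, (m : ℝ) ≤ (C / (k : ℝ)) ^ ((k : ℝ) / 2) * ((n : ℝ) ^ k / δ ^ 2) ∧
          HasTester n k δ η m) ∧
      (∀ n : ℕ, 2 ≤ n → ∀ δ : ℝ, 0 < δ →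
        ∃ m : ℕ, (m : ℝ) ≤ C * (Real.log (n : ℝ) / δ ^ 2) ∧ HasTester n 1 δ η m) := by
  refine ⟨max (((4 / η + 1) * 27) ^ 2)
    (64 * (1 + Real.log (2 / η) / Real.log 2) + 1 / Real.log 2), ?_, ?_, ?_⟩
  · exact lt_max_of_lt_left (by positivity)
  · exact fun n k hk hkn δ hδ => exists_hasTester_le hk hkn hδ hη0 (le_max_left _ _)
  · exact fun n hn δ hδ => exists_hasTester_one_le hn hδ hη0 hη1 (le_max_right _ _)
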